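/- Let $(R,\mathfrak m,k)$ be a commutative Noetherian local ring, let $D(R)$ be the unbounded derived category of $R$-modules, and let $E(k)$ be an injective hull of the $R$-module $k$. Let $\operatorname{loc}(k)\subseteq D(R)$ be the smallest strictly full triangulated subcategory that contains $k$ and is closed under arbitrary (small) coproducts, and let $\operatorname{thick}(E(k))\subseteq D(R)$ be the smallest strictly full triangulated subcategory that contains $E(k)$ and is closed under direct summands (modules are regarded as complexes concentrated in degree $0$). Let $M\in\operatorname{loc}(k)$. If $\operatorname{RHom}_R(k,M)$ has finite-dimensional total cohomology, that is, if the $k$-vector space $\bigoplus_{n\in\mathbb Z}H^n(\operatorname{RHom}_R(k,M))=\bigoplus_{n\in\mathbb Z}\operatorname{Hom}_{D(R)}(k,M[n])$ is finite-dimensional, then $M\in\operatorname{thick}(E(k))$. -/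

import Mathlib

open CategoryTheory

universe w u

/-- `loc(P)`: the smallest strictly full triangulated subcategory of the derived category
`D(R)` that contains `P` and is closed under all small coproducts. -/
def locSubcategory {R : Type u} [CommRing R] [HasDerivedCategory.{w} (ModuleCat.{u} R)]
    (P : ObjectProperty (DerivedCategory (ModuleCat.{u} R))) :
    ObjectProperty (DerivedCategory (ModuleCat.{u} R)) :=
  fun X => ∀ Q : ObjectProperty (DerivedCategory (ModuleCat.{u} R)),
    Q.IsTriangulated → Q.IsClosedUnderIsomorphisms →
    (∀ J : Type u, Q.IsClosedUnderColimitsOfShape (Discrete J)) → P ≤ Q → Q X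

/-- An `R`-module, seen as a complex concentrated in degree `0`, as an object of `D(R)`. -/
noncomputable abbrev moduleInD (R : Type u) [CommRing R]
    [HasDerivedCategory.{w} (ModuleCat.{u} R)]
    (N : Type u) [AddCommGroup N] [Module R N] : DerivedCategory (ModuleCat.{u} R) :=
  (DerivedCategory.singleFunctor (ModuleCat.{u} R) 0).obj (ModuleCat.of R N)

/-- `f : N → E` exhibits `E` as an injective hull of `N`: the module `E` is injective, and `f` is
an essential monomorphism, i.e. `f` is injective and every submodule of `E` that meets the image
of `f` trivially is zero. -/
structure IsInjectiveHull {R : Type u} [CommRing R] {N E : Type u}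
    [AddCommGroup N] [Module R N] [AddCommGroup E] [Module R E] (f : N →ₗ[R] E) : Prop where
  injective_module : Module.Injective R E
  injective_map : Function.Injective f
  essential : ∀ S : Submodule R E, S ⊓ LinearMap.range f = ⊥ → S = ⊥

section RHom

variable (R : Type u) [CommRing R] [IsLocalRing R]
  [HasDerivedCategory.{w} (ModuleCat.{u} R)]

/-- Multiplication by a scalar `c` of the residue field `k`, as an endomorphism of `k` in
`D(R)`. -/
noncomputable def residueMul (c : IsLocalRing.ResidueField R) :
    moduleInD R (IsLocalRing.ResidueField R) ⟶ moduleInD R (IsLocalRing.ResidueField R) :=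
  (DerivedCategory.singleFunctor (ModuleCat.{u} R) 0).map
    (ModuleCat.ofHom (LinearMap.mulLeft R c))

/-- The cohomology `Hⁿ(RHom_R(k, M)) = Hom_{D(R)}(k, M[n])` of the complex of morphisms from the
residue field `k` to `M` in the derived category. -/
def RHomCohomology (M : DerivedCategory (ModuleCat.{u} R)) (n : ℤ) : Type w :=
  moduleInD R (IsLocalRing.ResidueField R) ⟶ M⟦n⟧

noncomputable instance (M : DerivedCategory (ModuleCat.{u} R)) (n : ℤ) :
    AddCommGroup (RHomCohomology R M n) :=
  inferInstanceAs (AddCommGroup (moduleInD R (IsLocalRing.ResidueField R) ⟶ M⟦n⟧))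

/-- The `k`-vector space structure on `Hⁿ(RHom_R(k, M))`, induced by the action of `k` on the
first argument: `c • f = f ∘ (multiplication by c)`. -/
noncomputable instance (M : DerivedCategory (ModuleCat.{u} R)) (n : ℤ) :
    Module (IsLocalRing.ResidueField R) (RHomCohomology R M n) where
  smul c f := (residueMul R c ≫ f :)
  one_smul f := by
    have h : residueMul R 1 = 𝟙 _ := by
      rw [residueMul, ← CategoryTheory.Functor.map_id]
      congr 1
      ext x
      simp
    exact (congrArg (· ≫ f) h).trans (Category.id_comp _)
  mul_smul c d f := by
    have h : residueMul R (c * d) = residueMul R c ≫ residueMul R d := by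
      rw [residueMul, residueMul, residueMul, ← CategoryTheory.Functor.map_comp]
      congr 1
      ext x
      simp [mul_left_comm]
    exact (congrArg (· ≫ f) h).trans (Category.assoc _ _ _)
  smul_zero c := Limits.comp_zero
  smul_add c f g := Preadditive.comp_add _ _ _ _ _ _
  add_smul c d f := by
    have h : residueMul R (c + d) = residueMul R c + residueMul R d := by
      rw [residueMul, residueMul, residueMul, ← CategoryTheory.Functor.map_add]
      congr 1
      ext x
      simp [add_mul]
    exact (congrArg (· ≫ f) h).trans (Preadditive.add_comp _ _ _ _ _ _)
  zero_smul f := by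
    have h : residueMul R 0 = 0 := by
      rw [residueMul, ← CategoryTheory.Functor.map_zero]
      congr 1
      ext x
      simp
    exact (congrArg (· ≫ f) h).trans Limits.zero_comp

/-- `RHom_R(k, M) ∈ Dᵇ(k)`: the total cohomology `⨁ₙ Hⁿ(RHom_R(k, M))` is a finite-dimensional
`k`-vector space. -/
def RHomResidueFieldFinite (M : DerivedCategory (ModuleCat.{u} R)) : Prop :=
  Module.Finite (IsLocalRing.ResidueField R) (DirectSum ℤ fun n => RHomCohomology R M n)

end RHom

/-! The object `M` is built from finitely many shifts of `E = E(k)` by extensions, peeling off one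
copy of `E` at a time; direct summands are never needed. Membership in loc(k) enters only through
one consequence: the cohomology of `M` is torsion for the maximal ideal
(`isTorsionComplex_of_locSubcategory`). Finiteness of RHom(k, M) gives Hom(k, M[n]) = 0 for n ≪ 0,
and for a torsion complex this forces H^n(M) = 0 for n ≪ 0 (`isZero_homology_of_homVanishesNonpos`).
Indeed a cohomology class is a map from a shift of R. It factors through a Koszul complex on powers
of generators of the maximal ideal, whose cohomology has finite length, so it is filtered by copies
of k. If M ≠ 0, shift its lowest nonzero cohomology to degree 0. This module is torsion, hence
contains k, and injectivity of E yields k → M → E with composite ι (`exists_fac_injectiveHull`).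
Since RHom(k, E) is k·ι in degree 0, the map RHom(k, M) → RHom(k, E) is surjective on cohomology.
The fiber of M → E is therefore again torsion, with strictly smaller total dimension
(`finrank_totalRHom_fiber_lt`), and induction applies. -/

namespace DerivedCategory

/-! ### Morphisms from a projective object in degree 0. -/

open Limits HomologicalComplex Pretriangulated

variable {C : Type*} [Category* C] [Abelian C]

open CochainComplex.HomComplex in
/-- A morphism from a single complex which factors through the differential is null-homotopic. -/
noncomputable def homotopyZeroOfSingle {P : C} {K : CochainComplex C ℤ}
    (g : (CochainComplex.singleFunctor C 0).obj P ⟶ K) (l : P ⟶ K.X (-1))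
    (hl : l ≫ K.d (-1) 0 = (singleObjXSelf (.up ℤ) 0 P).inv ≫ g.f 0) : Homotopy g 0 :=
  (Cochain.equivHomotopy g 0).symm
    ⟨Cochain.fromSingleMk l (by lia), by
      apply (Cochain.fromSingleEquiv (add_zero 0)).injective
      rw [Cochain.δ_fromSingleMk l (by lia) 0 0 (by lia), hl, map_add,
        Cochain.fromSingleEquiv_fromSingleMk, Cochain.ofHom_zero, map_zero, add_zero]
      exact congrArg _ (Cochain.ofHom_v g 0)⟩

/-- The cocycle-valued map on `P` has zero class, so it lands in the boundaries; projectivity lifts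
it through the differential, and the lift is the homotopy. -/
lemma exists_homotopy_zero_of_homologyMap_eq_zero {P : C} [Projective P] {K : CochainComplex C ℤ}
    (g : (single C (.up ℤ) 0).obj P ⟶ K) (hg : homologyMap g 0 = 0) :
    Nonempty (Homotopy g 0) := by
  let f : P ⟶ K.X 0 := (singleObjXSelf (.up ℤ) 0 P).inv ≫ g.f 0
  have hf : f ≫ K.d 0 1 = 0 := by
    simp [f]
  let c : P ⟶ ((single C (.up ℤ) 0).obj P).cycles 0 :=
    liftCycles _ (singleObjXSelf (.up ℤ) 0 P).inv 1 (by simp) (by simp)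
  have hc : K.liftCycles f 1 (by simp) hf = c ≫ cyclesMap g 0 := by
    rw [← cancel_mono (K.iCycles 0)]
    simp [c, f]
  have hπ : K.liftCycles f 1 (by simp) hf ≫ K.homologyπ 0 = 0 := by
    rw [hc, Category.assoc, ← homologyπ_naturality, hg, comp_zero, comp_zero]
  have hex : (ShortComplex.mk (K.toCycles (-1) 0) (K.homologyπ 0) (by simp)).Exact :=
    ShortComplex.exact_of_g_is_cokernel _ (K.homologyIsCokernel (-1) 0 (by simp))
  let l : P ⟶ K.X (-1) := hex.liftFromProjective (K.liftCycles f 1 (by simp) hf) hπ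
  have hl : l ≫ K.d (-1) 0 = f := by
    have := hex.liftFromProjective_comp (K.liftCycles f 1 (by simp) hf) hπ
    have := congr($this ≫ K.iCycles 0)
    simpa [l] using this
  exact ⟨homotopyZeroOfSingle g l hl⟩

variable [HasDerivedCategory C]

/-- The cohomology of the image of a complex in the derived category. -/
noncomputable def homologyQIso (K : CochainComplex C ℤ) (n : ℤ) :
    (homologyFunctor C n).obj (Q.obj K) ≅ K.homology n :=
  (homologyFunctorFactors C n).app K

lemma homologyQIso_inv_naturality {K L : CochainComplex C ℤ} (g : K ⟶ L) (n : ℤ) :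
    (homologyQIso K n).inv ≫ (homologyFunctor C n).map (Q.map g) =
      homologyMap g n ≫ (homologyQIso L n).inv :=
  ((homologyFunctorFactors C n).inv.naturality g).symm

lemma homologyQIso_hom_naturality {K L : CochainComplex C ℤ} (g : K ⟶ L) (n : ℤ) :
    (homologyFunctor C n).map (Q.map g) ≫ (homologyQIso L n).hom =
      (homologyQIso K n).hom ≫ homologyMap g n :=
  (homologyFunctorFactors C n).hom.naturality g

lemma homologyMap_eq_zero_iff {K L : CochainComplex C ℤ} (g : K ⟶ L) (n : ℤ) :
    homologyMap g n = 0 ↔ (homologyFunctor C n).map (Q.map g) = 0 := by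
  have h := homologyQIso_hom_naturality g n
  constructor
  · intro h0
    rwa [h0, comp_zero, Preadditive.IsIso.comp_right_eq_zero] at h
  · intro h0
    rwa [h0, zero_comp, eq_comm, Preadditive.IsIso.comp_left_eq_zero] at h

/-- A morphism from a projective object in degree `0` is detected by its action on `H⁰`. -/
lemma eq_zero_of_homologyFunctor_map_eq_zero {P : C} [Projective P] {X : DerivedCategory C}
    (g : (singleFunctor C 0).obj P ⟶ X) (hg : (homologyFunctor C 0).map g = 0) : g = 0 := by
  let e := Q.objObjPreimageIso X
  let g₁ : Q.obj ((single C (.up ℤ) 0).obj P) ⟶ Q.obj (Q.objPreimage X) :=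
    g ≫ e.inv
  suffices h : g₁ = 0 from
    (Preadditive.IsIso.comp_right_eq_zero g e.inv).1 h
  have hg₁ : (homologyFunctor C 0).map g₁ = 0 := by
    refine ((homologyFunctor C 0).map_comp g e.inv).trans ?_
    rw [hg]
    exact zero_comp
  clear_value g₁
  -- A left fraction keeps the source equal to `P` in degree 0, so its numerator `f` is a chain map
  -- to which the homotopy criterion applies.
  obtain ⟨K, f, s, _, rfl⟩ := left_fac g₁
  have hf : (homologyFunctor C 0).map (Q.map f) = 0 := by
    rw [Functor.map_comp] at hg₁
    rwa [← cancel_mono ((homologyFunctor C 0).map (inv (Q.map s))), zero_comp]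
  rw [← homologyMap_eq_zero_iff] at hf
  obtain ⟨h⟩ := exists_homotopy_zero_of_homologyMap_eq_zero f hf
  rw [Q_map_eq_of_homotopy _ h, Functor.map_zero, zero_comp]

/-- Every morphism from a projective object `P` to `H⁰(X)` is induced by a morphism `P ⟶ X`
in the derived category. -/
lemma exists_comp_homologyFunctor_map_eq {P : C} [Projective P] {X : DerivedCategory C}
    (x : P ⟶ (homologyFunctor C 0).obj X) :
    ∃ (g : (singleFunctor C 0).obj P ⟶ X)
      (e : P ⟶ (homologyFunctor C 0).obj ((singleFunctor C 0).obj P)),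
      e ≫ (homologyFunctor C 0).map g = x := by
  let e := Q.objObjPreimageIso X
  let K := Q.objPreimage X
  let x₁ : P ⟶ K.homology 0 :=
    x ≫ (homologyFunctor C 0).map e.inv ≫ (homologyQIso K 0).hom
  let y : P ⟶ K.cycles 0 := Projective.factorThru x₁ (K.homologyπ 0)
  let g : (single C (.up ℤ) 0).obj P ⟶ K :=
    mkHomFromSingle (y ≫ K.iCycles 0) (by simp)
  let c : P ⟶ ((single C (.up ℤ) 0).obj P).cycles 0 :=
    liftCycles _ (singleObjXSelf (.up ℤ) 0 P).inv 1 (by simp) (by simp)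
  have hc : c ≫ cyclesMap g 0 = y := by
    rw [← cancel_mono (K.iCycles 0)]
    simp [c, g]
  have hg : (c ≫ homologyπ _ 0) ≫ homologyMap g 0 = x₁ := by
    rw [Category.assoc, homologyπ_naturality, ← Category.assoc, hc]
    exact Projective.factorThru_comp _ _
  let c' : P ⟶ (homologyFunctor C 0).obj (Q.obj ((single C (.up ℤ) 0).obj P)) :=
    (c ≫ homologyπ _ 0) ≫ (homologyQIso _ 0).inv
  have h : c' ≫ (homologyFunctor C 0).map (Q.map g ≫ e.hom) = x := by
    rw [Functor.map_comp, Category.assoc, ← Category.assoc (homologyQIso _ 0).inv,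
      homologyQIso_inv_naturality, Category.assoc (homologyMap g 0),
      ← Category.assoc _ (homologyMap g 0), hg]
    simp [x₁, ← Functor.map_comp]
  exact ⟨Q.map g ≫ e.hom, c', h⟩

end DerivedCategory

/-! ### Objects of loc(k) have torsion cohomology. -/

lemma smul_residueField_eq_zero {R : Type u} [CommRing R] [IsLocalRing R] {a : R}
    (ha : a ∈ IsLocalRing.maximalIdeal R)
    (x : IsLocalRing.ResidueField R) : a • x = 0 := by
  rw [Algebra.smul_def, IsLocalRing.ResidueField.algebraMap_eq,
    (IsLocalRing.residue_eq_zero_iff a).2 ha, zero_mul]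

namespace DerivedCategory

open Limits HomologicalComplex Pretriangulated

section Linear

variable {S : Type*} [CommRing S] {C : Type*} [Category* C] [Abelian C] [Linear S C]

instance (n : ℤ) : (HomologicalComplex.homologyFunctor C (.up ℤ) n).Linear S where
  map_smul f r := by
    exact ShortComplex.homologyMap_smul ((shortComplexFunctor C (.up ℤ) n).map f) r

variable [HasDerivedCategory C]

instance (n : ℤ) : (homologyFunctor C n).Linear S := by
  let _ : Localization.Lifting Q (HomologicalComplex.quasiIso C (.up ℤ))
    (HomologicalComplex.homologyFunctor C (.up ℤ) n) (homologyFunctor C n) :=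
    ⟨homologyFunctorFactors C n⟩
  exact (Localization.functor_linear_iff Q (HomologicalComplex.quasiIso C (.up ℤ)) S
    (HomologicalComplex.homologyFunctor C (.up ℤ) n) (homologyFunctor C n)).1 inferInstance

end Linear

section PowerTorsion

variable {R : Type u} [CommRing R]

/-- Every element of the module `N` is annihilated by a power of `a`. -/
def IsPowerTorsion (a : R) (N : Type*) [AddCommGroup N] [Module R N] : Prop :=
  ∀ x : N, ∃ n : ℕ, a ^ n • x = 0

section

variable {a : R} {N₁ N₂ N₃ : Type*} [AddCommGroup N₁] [Module R N₁] [AddCommGroup N₂]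
  [Module R N₂] [AddCommGroup N₃] [Module R N₃]

lemma IsPowerTorsion.of_exact {f : N₁ →ₗ[R] N₂} {g : N₂ →ₗ[R] N₃} (h : Function.Exact f g)
    (h₁ : IsPowerTorsion a N₁) (h₃ : IsPowerTorsion a N₃) : IsPowerTorsion a N₂ := by
  intro x
  obtain ⟨n, hn⟩ := h₃ (g x)
  rw [← map_smul] at hn
  obtain ⟨y, hy⟩ := (h _).1 hn
  obtain ⟨m, hm⟩ := h₁ y
  refine ⟨m + n, ?_⟩
  rw [pow_add, mul_smul, ← hy, ← map_smul, hm, map_zero]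

lemma IsPowerTorsion.of_injective (f : N₁ →ₗ[R] N₂) (hf : Function.Injective f)
    (h : IsPowerTorsion a N₂) : IsPowerTorsion a N₁ := by
  intro x
  obtain ⟨n, hn⟩ := h (f x)
  exact ⟨n, hf (by rw [map_smul, hn, map_zero])⟩

lemma IsPowerTorsion.of_surjective (f : N₁ →ₗ[R] N₂) (hf : Function.Surjective f)
    (h : IsPowerTorsion a N₁) : IsPowerTorsion a N₂ := by
  intro x
  obtain ⟨y, rfl⟩ := hf x
  obtain ⟨n, hn⟩ := h y
  exact ⟨n, by rw [← map_smul, hn, map_zero]⟩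

end

lemma IsPowerTorsion.of_iso {a : R} {N₁ N₂ : ModuleCat.{u} R} (e : N₁ ≅ N₂)
    (h : IsPowerTorsion a N₁) : IsPowerTorsion a N₂ :=
  h.of_surjective e.toLinearEquiv.toLinearMap e.toLinearEquiv.surjective

lemma IsPowerTorsion.of_isZero {a : R} {N : ModuleCat.{u} R} (h : IsZero N) :
    IsPowerTorsion a N := by
  have := ModuleCat.subsingleton_of_isZero h
  exact fun x => ⟨0, Subsingleton.elim _ _⟩

end PowerTorsion

section Localization

variable {R : Type u} [CommRing R] (a : R)

/-- Localization at the powers of `a`, as an endofunctor of the category of `R`-modules. -/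
noncomputable def awayFunctor : ModuleCat.{u} R ⥤ ModuleCat.{u} R where
  obj N := ModuleCat.of R (LocalizedModule (Submonoid.powers a) N)
  map f := ModuleCat.ofHom (IsLocalizedModule.map (Submonoid.powers a)
    (LocalizedModule.mkLinearMap (Submonoid.powers a) _)
    (LocalizedModule.mkLinearMap (Submonoid.powers a) _) f.hom)
  map_id N := by
    ext1
    exact IsLocalizedModule.map_id _ _
  map_comp f g := by
    ext1
    exact IsLocalizedModule.map_comp' _ _ _ _ _ _

instance : (awayFunctor a).Additive where
  map_add {_ _ f g} := by
    ext1
    exact map_add (IsLocalizedModule.map (Submonoid.powers a) _ _) f.hom g.hom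

/-- The complex obtained from `K` by localizing at the powers of `a`. -/
noncomputable abbrev awayComplex (K : CochainComplex (ModuleCat.{u} R) ℤ) :
    CochainComplex (ModuleCat.{u} R) ℤ :=
  ((awayFunctor a).mapHomologicalComplex _).obj K

/-- The canonical map from a complex to its localization. -/
noncomputable def toAwayComplex (K : CochainComplex (ModuleCat.{u} R) ℤ) :
    K ⟶ awayComplex a K where
  f n := ModuleCat.ofHom (LocalizedModule.mkLinearMap (Submonoid.powers a) (K.X n))
  comm' i j _ := by
    refine ModuleCat.hom_ext (LinearMap.ext fun x => ?_)
    exact IsLocalizedModule.map_apply (Submonoid.powers a)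
      (LocalizedModule.mkLinearMap (Submonoid.powers a) _)
      (LocalizedModule.mkLinearMap (Submonoid.powers a) _) (K.d i j).hom x

instance (K : CochainComplex (ModuleCat.{u} R) ℤ) : IsIso (a • 𝟙 (awayComplex a K)) := by
  have : ∀ n, IsIso ((a • 𝟙 (awayComplex a K)).f n) := by
    intro n
    rw [ConcreteCategory.isIso_iff_bijective]
    have := IsLocalizedModule.map_units
      (LocalizedModule.mkLinearMap (Submonoid.powers a) (K.X n))
      ⟨a, Submonoid.mem_powers a⟩
    rw [Module.End.isUnit_iff] at this
    exact this
  exact Hom.isIso_of_components _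

/-- A cocycle whose class dies after localization is a boundary there; clearing denominators makes a
multiple of it by a power of `a` a boundary in `K` itself. -/
lemma isPowerTorsion_homology_of_homologyMap_eq_zero (K : CochainComplex (ModuleCat.{u} R) ℤ)
    (n : ℤ) (h : homologyMap (toAwayComplex a K) n = 0) : IsPowerTorsion a (K.homology n) := by
  intro x
  obtain ⟨z, rfl⟩ := (ModuleCat.epi_iff_surjective (K.homologyπ n)).1 inferInstance x
  have hz : (awayComplex a K).homologyπ n (cyclesMap (toAwayComplex a K) n z) = 0 := by
    have := congr($(homologyπ_naturality (toAwayComplex a K) n) z)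
    rw [h] at this
    simpa using this.symm
  have hex : (ShortComplex.mk ((awayComplex a K).toCycles (n - 1) n)
      ((awayComplex a K).homologyπ n) (by simp)).Exact :=
    ShortComplex.exact_of_g_is_cokernel _ ((awayComplex a K).homologyIsCokernel _ _ (by simp))
  rw [ShortComplex.moduleCat_exact_iff] at hex
  obtain ⟨y, hy⟩ := hex _ hz
  let η (m : ℤ) := LocalizedModule.mkLinearMap (Submonoid.powers a) (K.X m)
  have hη (m m' : ℤ) (v : K.X m) : (awayComplex a K).d m m' (η m v) = η m' (K.d m m' v) :=
    congr($((toAwayComplex a K).comm m m') v)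
  have hy' : (awayComplex a K).d (n - 1) n y = η n (K.iCycles n z) := by
    have h₁ := congr((awayComplex a K).iCycles n $hy)
    have h₂ := congr($(cyclesMap_i (toAwayComplex a K) n) z)
    have h₃ := congr($((awayComplex a K).toCycles_i (n - 1) n) y)
    exact h₃.symm.trans (h₁.trans h₂)
  obtain ⟨⟨v, s⟩, hv⟩ := IsLocalizedModule.surj (Submonoid.powers a) (η (n - 1)) y
  have h₄ : η n ((s : R) • K.iCycles n z) = η n (K.d (n - 1) n v) := by
    rw [map_smul, ← hy', ← hη, ← hv]
    exact (map_smul ((awayComplex a K).d (n - 1) n).hom (s : R) y).symm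
  -- `s` cleared the denominator of `y`; a second power `t` turns the equality in the localization
  -- into one in `K`.
  obtain ⟨t, ht⟩ := (IsLocalizedModule.eq_iff_exists (Submonoid.powers a) (η n)).1 h₄
  have h₅ : (t : R) • (s : R) • z = K.toCycles (n - 1) n ((t : R) • v) := by
    apply (ModuleCat.mono_iff_injective (K.iCycles n)).1 inferInstance
    have h₆ := congr($(K.toCycles_i (n - 1) n) ((t : R) • v))
    refine Eq.trans ?_ h₆.symm
    rw [map_smul, map_smul, map_smul]
    exact ht
  obtain ⟨m, hm⟩ := s.2
  obtain ⟨l, hl⟩ := t.2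
  refine ⟨l + m, ?_⟩
  have hl' : a ^ l = t := hl
  have hm' : a ^ m = s := hm
  rw [pow_add, mul_smul, hl', hm', ← map_smul, ← map_smul, h₅]
  exact congr($(K.toCycles_comp_homologyπ (n - 1) n) ((t : R) • v))

variable [HasDerivedCategory.{w} (ModuleCat.{u} R)]

/-- The objects on which multiplication by `a` is invertible. -/
def smulIsIso : ObjectProperty (DerivedCategory (ModuleCat.{u} R)) :=
  fun Y => IsIso (a • 𝟙 Y)

instance : (smulIsIso (R := R) a).IsStableUnderShift ℤ where
  isStableUnderShiftBy n := ⟨fun Y hY => by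
    have hY' : IsIso (a • 𝟙 Y) := hY
    have h : (a • 𝟙 Y)⟦n⟧' = a • 𝟙 (Y⟦n⟧) := by
      rw [Functor.map_smul, CategoryTheory.Functor.map_id]
    change IsIso (a • 𝟙 (Y⟦n⟧))
    rw [← h]
    infer_instance⟩

/-- Multiplication by `a` is invertible on the localized complex, so orthogonality kills the
canonical map from `X` to its localization. -/
lemma isPowerTorsion_homology_of_leftOrthogonal {X : DerivedCategory (ModuleCat.{u} R)}
    (hX : (smulIsIso a).leftOrthogonal X) (n : ℤ) :
    IsPowerTorsion a ((homologyFunctor (ModuleCat.{u} R) n).obj X) := by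
  let e := Q.objObjPreimageIso X
  let K := Q.objPreimage X
  have hK : smulIsIso a (Q.obj (awayComplex a K)) := by
    have h : Q.map (a • 𝟙 (awayComplex a K)) = a • 𝟙 (Q.obj (awayComplex a K)) := by
      rw [Functor.map_smul, CategoryTheory.Functor.map_id]
    change IsIso _
    rw [← h]
    infer_instance
  have h₀ : Q.map (toAwayComplex a K) = 0 := by
    rw [← Preadditive.IsIso.comp_left_eq_zero e.inv]
    exact hX _ hK
  have h₁ : homologyMap (toAwayComplex a K) n = 0 := by
    rw [homologyMap_eq_zero_iff, h₀, Functor.map_zero]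
  exact (isPowerTorsion_homology_of_homologyMap_eq_zero a K n h₁).of_iso
    ((homologyQIso K n).symm ≪≫ (homologyFunctor _ n).mapIso e)

lemma leftOrthogonal_isClosedUnderColimitsOfShape {C : Type*} [Category* C] [HasZeroMorphisms C]
    (P : ObjectProperty C) (J : Type*) [Category* J] :
    P.leftOrthogonal.IsClosedUnderColimitsOfShape J where
  colimitsOfShape_le := by
    rintro X ⟨h⟩ Y f hY
    refine h.isColimit.hom_ext fun j => ?_
    rw [comp_zero]
    exact h.prop_diag_obj j _ hY

/-- On a morphism `N ⟶ Y`, the scalar `a` acts by zero through `N` and invertibly through `Y`. -/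
lemma leftOrthogonal_smulIsIso {N : Type u} [AddCommGroup N] [Module R N]
    (hN : ∀ x : N, a • x = 0) : (smulIsIso a).leftOrthogonal (moduleInD R N) := by
  intro Y f hY
  have hY' : IsIso (a • 𝟙 Y) := hY
  rw [← Preadditive.IsIso.comp_right_eq_zero f (a • 𝟙 Y), Linear.comp_smul, Category.comp_id]
  have h : a • 𝟙 (moduleInD R N) = 0 := by
    rw [← CategoryTheory.Functor.map_id, ← Functor.map_smul]
    have h₀ : a • 𝟙 (ModuleCat.of R N) = 0 := by
      ext x
      exact hN x
    rw [h₀, Functor.map_zero]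
  rw [← Category.id_comp f, ← Linear.smul_comp, h, zero_comp]

end Localization

/-- All the cohomology modules of `X` are torsion with respect to the maximal ideal. -/
def IsTorsionComplex {R : Type u} [CommRing R] [IsLocalRing R]
    [HasDerivedCategory.{w} (ModuleCat.{u} R)] :
    ObjectProperty (DerivedCategory (ModuleCat.{u} R)) :=
  fun X => ∀ a ∈ IsLocalRing.maximalIdeal R, ∀ n : ℤ,
    IsPowerTorsion a ((homologyFunctor (ModuleCat.{u} R) n).obj X)

/-- For each `a`, the left orthogonal of `smulIsIso a` is triangulated, closed under coproducts and
contains k, so it contains loc(k). -/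
lemma isTorsionComplex_of_locSubcategory {R : Type u} [CommRing R] [IsLocalRing R]
    [HasDerivedCategory.{w} (ModuleCat.{u} R)]
    {M : DerivedCategory (ModuleCat.{u} R)}
    (hM : locSubcategory
      (ObjectProperty.singleton (moduleInD R (IsLocalRing.ResidueField R))) M) :
    IsTorsionComplex M := by
  intro a ha n
  refine isPowerTorsion_homology_of_leftOrthogonal a (hM (smulIsIso a).leftOrthogonal
    inferInstance inferInstance
    (fun J => leftOrthogonal_isClosedUnderColimitsOfShape _ _) ?_) n
  rw [ObjectProperty.singleton_le_iff]
  exact leftOrthogonal_smulIsIso a (smul_residueField_eq_zero ha)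

end DerivedCategory

/-! ### Factoring cohomology classes through Koszul complexes. -/

namespace DerivedCategory

open Limits HomologicalComplex Pretriangulated

section

variable {C : Type*} [Category* C] [Abelian C] [HasDerivedCategory C]

/-- The cohomology of a shifted object. -/
noncomputable def homologyShiftIso (X : DerivedCategory C) (k n m : ℤ) (h : k + n = m) :
    (homologyFunctor C n).obj (X⟦k⟧) ≅ (homologyFunctor C m).obj X :=
  ((homologyFunctor C 0).shiftIso k n m h).app X

lemma exists_eq_shift_map_comp {F Y : DerivedCategory C} (f : F⟦(1 : ℤ)⟧ ⟶ Y) :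
    ∃ (g : F ⟶ Y⟦(-1 : ℤ)⟧) (c : (Y⟦(-1 : ℤ)⟧)⟦(1 : ℤ)⟧ ⟶ Y), f = g⟦(1 : ℤ)⟧' ≫ c := by
  obtain ⟨g, rfl⟩ := ((shiftEquiv (DerivedCategory C)
    (1 : ℤ)).toAdjunction.homEquiv _ _).symm.surjective f
  exact ⟨g, _, Adjunction.homEquiv_counit _ _ _ _⟩

lemma exists_eq_comp_of_distTriang {X Y Z W : DerivedCategory C} {f : X ⟶ Y} {g : Y ⟶ Z}
    {h : Z ⟶ X⟦(1 : ℤ)⟧} (hT : Triangle.mk f g h ∈ distTriang _) (v : Y ⟶ W) (hv : f ≫ v = 0) :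
    ∃ w : Z ⟶ W, v = g ≫ w :=
  Triangle.yoneda_exact₂ _ hT v hv

lemma isZero_homology_obj₃ (T : Triangle (DerivedCategory C)) (hT : T ∈ distTriang _) (n : ℤ)
    (h₂ : IsZero ((homologyFunctor C n).obj T.obj₂))
    (h₁ : IsZero ((homologyFunctor C (n + 1)).obj T.obj₁)) :
    IsZero ((homologyFunctor C n).obj T.obj₃) :=
  (HomologySequence.exact₃ T hT n (n + 1)).isZero_of_both_zeros
    (h₂.eq_of_src _ _) (h₁.eq_of_tgt _ _)

end

section Module

variable {R : Type u} [CommRing R]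

lemma finite_of_exact [IsNoetherianRing R] (S : ShortComplex (ModuleCat.{u} R)) (hS : S.Exact)
    (h₁ : Module.Finite R S.X₁) (h₃ : Module.Finite R S.X₃) : Module.Finite R S.X₂ := by
  have := isNoetherian_of_range_eq_ker S.f.hom S.g.hom hS.moduleCat_range_eq_ker
  infer_instance

lemma IsPowerTorsion.of_shortComplex_exact {a : R} (S : ShortComplex (ModuleCat.{u} R))
    (hS : S.Exact) (h₁ : IsPowerTorsion a S.X₁) (h₃ : IsPowerTorsion a S.X₃) :
    IsPowerTorsion a S.X₂ :=
  IsPowerTorsion.of_exact (LinearMap.exact_iff.2 hS.moduleCat_range_eq_ker.symm) h₁ h₃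

variable [HasDerivedCategory.{w} (ModuleCat.{u} R)]

noncomputable abbrev singleHomologyIso (N : ModuleCat.{u} R) :
    (homologyFunctor (ModuleCat.{u} R) 0).obj ((singleFunctor (ModuleCat.{u} R) 0).obj N) ≅ N :=
  (singleFunctorCompHomologyFunctorIso (ModuleCat.{u} R) 0).app N

lemma isZero_homology_single (N : ModuleCat.{u} R) (n : ℤ) (hn : n ≠ 0) :
    IsZero ((homologyFunctor (ModuleCat.{u} R) n).obj
      ((singleFunctor (ModuleCat.{u} R) 0).obj N)) := by
  rcases hn.lt_or_gt with h | h
  · exact isZero_of_isGE _ 0 n h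
  · exact isZero_of_isLE _ 0 n h

lemma isPowerTorsion_homology_single {a : R} (N : ModuleCat.{u} R) (hN : IsPowerTorsion a N)
    (n : ℤ) : IsPowerTorsion a ((homologyFunctor (ModuleCat.{u} R) n).obj
      ((singleFunctor (ModuleCat.{u} R) 0).obj N)) := by
  by_cases hn : n = 0
  · subst hn
    exact hN.of_iso (singleHomologyIso N).symm
  · exact .of_isZero (isZero_homology_single N n hn)

lemma finite_homology_single (N : ModuleCat.{u} R) [Module.Finite R N]
    (n : ℤ) : Module.Finite R ((homologyFunctor (ModuleCat.{u} R) n).obj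
      ((singleFunctor (ModuleCat.{u} R) 0).obj N)) := by
  by_cases hn : n = 0
  · subst hn
    exact Module.Finite.equiv (singleHomologyIso N).symm.toLinearEquiv
  · have := ModuleCat.subsingleton_of_isZero (isZero_homology_single N n hn)
    infer_instance

/-- Each cohomology module of the cone is an extension of a kernel by a cokernel of `a ^ N`, so `a ^
(N + N)` kills it. -/
lemma isPowerTorsion_cone_smul {a : R} {N : ℕ} {F G : DerivedCategory (ModuleCat.{u} R)}
    {p : F ⟶ G} {q : G ⟶ F⟦(1 : ℤ)⟧} (hT : Triangle.mk (a ^ N • 𝟙 F) p q ∈ distTriang _) (n : ℤ) :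
    IsPowerTorsion a ((homologyFunctor (ModuleCat.{u} R) n).obj G) := by
  intro x
  have hmap (m : ℤ) (z : (homologyFunctor (ModuleCat.{u} R) m).obj F) :
      (homologyFunctor (ModuleCat.{u} R) m).map (a ^ N • 𝟙 F) z = a ^ N • z := by
    rw [Functor.map_smul, CategoryTheory.Functor.map_id]
    rfl
  have hex := (ShortComplex.moduleCat_exact_iff _).1 (HomologySequence.exact₃ _ hT n (n + 1))
  obtain ⟨y, hy⟩ := hex (a ^ N • x) (by
    have := congr($(HomologySequence.δ_comp _ hT n (n + 1)) x)
    refine (map_smul (ModuleCat.Hom.hom _) _ _).trans ?_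
    exact (hmap _ _).symm.trans this)
  refine ⟨N + N, ?_⟩
  rw [pow_add, mul_smul, ← hy]
  have h₀ : (homologyFunctor (ModuleCat.{u} R) n).map (a ^ N • 𝟙 F) ≫
      (homologyFunctor (ModuleCat.{u} R) n).map p = 0 := by
    rw [← Functor.map_comp, show (a ^ N • 𝟙 F) ≫ p = 0 from comp_distTriang_mor_zero₁₂ _ hT,
      Functor.map_zero]
  have h₁ := congr($h₀ y)
  have h₂ : (homologyFunctor (ModuleCat.{u} R) n).map p (a ^ N • y) = 0 :=
    (congrArg _ (hmap n y).symm).trans h₁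
  exact (map_smul (ModuleCat.Hom.hom _) _ _).symm.trans h₂

end Module

section Local

variable {R : Type u} [CommRing R] [IsLocalRing R] [HasDerivedCategory.{w} (ModuleCat.{u} R)]

lemma IsTorsionComplex.shift {X : DerivedCategory (ModuleCat.{u} R)} (hX : IsTorsionComplex X)
    (k : ℤ) : IsTorsionComplex (X⟦k⟧) :=
  fun a ha n => (hX a ha (k + n)).of_iso (homologyShiftIso X k n _ rfl).symm

/-- Every morphism from `F` to a torsion complex is annihilated by a power of each element of the
maximal ideal. -/
def HasTorsionHoms (F : DerivedCategory (ModuleCat.{u} R)) : Prop :=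
  ∀ Y, IsTorsionComplex Y → ∀ f : F ⟶ Y, ∀ a ∈ IsLocalRing.maximalIdeal R, ∃ N : ℕ, a ^ N • f = 0

/-- A map from R is determined by the image of 1 in H⁰(Y), which is a torsion element. -/
lemma hasTorsionHoms_ring : HasTorsionHoms (moduleInD R R) := by
  intro Y hY f a ha
  let e := singleHomologyIso (ModuleCat.of R R)
  let g := e.inv ≫ (homologyFunctor (ModuleCat.{u} R) 0).map f
  obtain ⟨N, hN⟩ := hY a ha 0 (g (1 : R))
  refine ⟨N, eq_zero_of_homologyFunctor_map_eq_zero _ ?_⟩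
  rw [Functor.map_smul, ← Preadditive.IsIso.comp_left_eq_zero e.inv, Linear.comp_smul]
  refine ModuleCat.hom_ext (LinearMap.ext_ring ?_)
  exact hN

lemma HasTorsionHoms.shift_one {F : DerivedCategory (ModuleCat.{u} R)} (hF : HasTorsionHoms F) :
    HasTorsionHoms (F⟦(1 : ℤ)⟧) := by
  intro Y hY f a ha
  obtain ⟨g, c, rfl⟩ := exists_eq_shift_map_comp f
  obtain ⟨N, hN⟩ := hF (Y⟦(-1 : ℤ)⟧) (hY.shift _) g a ha
  exact ⟨N, by rw [← Linear.smul_comp, ← Functor.map_smul, hN, Functor.map_zero, zero_comp]⟩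

lemma HasTorsionHoms.obj₃ (T : Triangle (DerivedCategory (ModuleCat.{u} R)))
    (hT : T ∈ distTriang _) (h₁ : HasTorsionHoms T.obj₁) (h₂ : HasTorsionHoms T.obj₂) :
    HasTorsionHoms T.obj₃ := by
  intro Y hY f a ha
  obtain ⟨N, hN⟩ := h₂ Y hY (T.mor₂ ≫ f) a ha
  rw [← Linear.comp_smul] at hN
  obtain ⟨g, hg⟩ := Triangle.yoneda_exact₃ T hT _ hN
  obtain ⟨M, hM⟩ := h₁.shift_one Y hY g a ha
  refine ⟨M + N, ?_⟩
  rw [pow_add, mul_smul, hg, ← Linear.comp_smul, hM, comp_zero]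

/-- A morphism from `R` to a torsion complex factors through a bounded complex in nonpositive
degrees with finitely generated cohomology, torsion with respect to given elements of the maximal
ideal. -/
lemma exists_factorization_of_isTorsionComplex [IsNoetherianRing R]
    {X : DerivedCategory (ModuleCat.{u} R)} (hX : IsTorsionComplex X) (z : moduleInD R R ⟶ X)
    (s : Finset R) (hs : ∀ a ∈ s, a ∈ IsLocalRing.maximalIdeal R) :
    ∃ (F : DerivedCategory (ModuleCat.{u} R)) (u : moduleInD R R ⟶ F) (v : F ⟶ X),
      u ≫ v = z ∧ F.IsLE 0 ∧ (∃ r : ℕ, F.IsGE (-r)) ∧ HasTorsionHoms F ∧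
      (∀ n, Module.Finite R ((homologyFunctor (ModuleCat.{u} R) n).obj F)) ∧
      ∀ a ∈ s, ∀ n, IsPowerTorsion a ((homologyFunctor (ModuleCat.{u} R) n).obj F) := by
  classical
  induction s using Finset.induction_on with
  | empty =>
    refine ⟨_, 𝟙 _, z, Category.id_comp _, inferInstance, ⟨0, ?_⟩, hasTorsionHoms_ring,
      fun n => finite_homology_single _ n, by simp⟩
    exact inferInstanceAs (IsGE _ 0)
  | insert a s _ ih =>
    obtain ⟨F, u, v, rfl, hLE, ⟨r, hGE⟩, hF, hfin, htors⟩ :=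
      ih fun b hb => hs b (Finset.mem_insert_of_mem hb)
    -- The induction carries `HasTorsionHoms F` so that some `a ^ N` kills `v`, which then extends
    -- over the cone of `a ^ N` on `F`. Each cone may add one degree at the bottom, whence `r + 1`.
    obtain ⟨N, hN⟩ := hF X hX v a (hs a (Finset.mem_insert_self _ _))
    obtain ⟨G, p, q, hT⟩ := distinguished_cocone_triangle (a ^ N • 𝟙 F)
    obtain ⟨v', rfl⟩ := exists_eq_comp_of_distTriang hT v (by
      rw [Linear.smul_comp, Category.id_comp, hN])
    refine ⟨G, u ≫ p, v', Category.assoc _ _ _, ?_, ⟨r + 1, ?_⟩, hF.obj₃ _ hT hF, fun n => ?_, ?_⟩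
    · rw [isLE_iff]
      exact fun i hi => isZero_homology_obj₃ _ hT i (isZero_of_isLE F 0 i hi)
        (isZero_of_isLE F 0 (i + 1) (by lia))
    · rw [isGE_iff]
      exact fun i hi => isZero_homology_obj₃ _ hT i (isZero_of_isGE F (-r) i (by lia))
        (isZero_of_isGE F (-r) (i + 1) (by lia))
    · exact finite_of_exact _ (HomologySequence.exact₃ _ hT n (n + 1)) (hfin n) (hfin (n + 1))
    · intro b hb n
      rw [Finset.mem_insert] at hb
      obtain rfl | hb := hb
      · exact isPowerTorsion_cone_smul hT n
      · exact IsPowerTorsion.of_shortComplex_exact _ (HomologySequence.exact₃ _ hT n (n + 1))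
          (htors b hb n) (htors b hb (n + 1))

end Local

end DerivedCategory

/-! ### Dévissage from the residue field to finite torsion complexes. -/

namespace DerivedCategory

open Limits HomologicalComplex Pretriangulated

variable {R : Type u} [CommRing R] [HasDerivedCategory.{w} (ModuleCat.{u} R)]

/-- `Y` receives no nonzero morphism from `N⟦-n⟧` for `n ≤ 0`. -/
def HomVanishesNonpos (N : ModuleCat.{u} R) (Y : DerivedCategory (ModuleCat.{u} R)) : Prop :=
  ∀ n : ℤ, n ≤ 0 → ∀ f : (singleFunctor (ModuleCat.{u} R) 0).obj N ⟶ Y⟦n⟧, f = 0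

lemma HomVanishesNonpos.shift {N : ModuleCat.{u} R} {Y : DerivedCategory (ModuleCat.{u} R)}
    (h : HomVanishesNonpos N Y) {k : ℤ} (hk : k ≤ 0) : HomVanishesNonpos N (Y⟦k⟧) := by
  intro n hn f
  rw [← Preadditive.IsIso.comp_right_eq_zero f ((shiftFunctorAdd _ k n).inv.app Y)]
  exact h (k + n) (by lia) _

lemma HomVanishesNonpos.of_iso {N N' : ModuleCat.{u} R} {Y : DerivedCategory (ModuleCat.{u} R)}
    (h : HomVanishesNonpos N Y) (e : N ≅ N') : HomVanishesNonpos N' Y := by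
  intro n hn f
  rw [← Preadditive.IsIso.comp_left_eq_zero
    ((singleFunctor (ModuleCat.{u} R) 0).map e.hom) f]
  exact h n hn _

lemma HomVanishesNonpos.of_shortExact {S : ShortComplex (ModuleCat.{u} R)} (hS : S.ShortExact)
    {Y : DerivedCategory (ModuleCat.{u} R)}
    (h₁ : HomVanishesNonpos S.X₁ Y) (h₃ : HomVanishesNonpos S.X₃ Y) :
    HomVanishesNonpos S.X₂ Y := by
  intro n hn f
  obtain ⟨g, rfl⟩ := Triangle.yoneda_exact₂ _ hS.singleTriangle_distinguished f (h₁ n hn _)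
  exact (congrArg _ (h₃ n hn g)).trans comp_zero

/-- Filter `N` with quotients R/p. Torsion puts a power of every generator of the maximal ideal into
p, so p is maximal and each quotient is k. -/
lemma HomVanishesNonpos.of_finite [IsLocalRing R] [IsNoetherianRing R]
    {Y : DerivedCategory (ModuleCat.{u} R)}
    (h : HomVanishesNonpos (ModuleCat.of R (IsLocalRing.ResidueField R)) Y)
    (s : Set R) (hs : Ideal.span s = IsLocalRing.maximalIdeal R)
    (N : Type u) [AddCommGroup N] [Module R N] [hN : Module.Finite R N]
    (htors : ∀ a ∈ s, IsPowerTorsion a N) : HomVanishesNonpos (ModuleCat.of R N) Y := by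
  revert htors
  induction hN using IsNoetherianRing.induction_on_isQuotientEquivQuotientPrime R with
  | subsingleton N =>
    intro _ n _ f
    have : IsZero (ModuleCat.of R N) := ModuleCat.isZero_of_subsingleton _
    exact ((singleFunctor (ModuleCat.{u} R) 0).map_isZero this).eq_of_src _ _
  | quotient N p e =>
    intro htors
    have hp : p.asIdeal = IsLocalRing.maximalIdeal R := by
      refine ((IsLocalRing.maximalIdeal.isMaximal R).eq_of_le p.2.ne_top ?_).symm
      rw [← hs, Ideal.span_le]
      intro a ha
      obtain ⟨n, hn⟩ := htors a ha (e.symm 1)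
      rw [← map_smul, LinearEquiv.map_eq_zero_iff, Algebra.smul_def, mul_one,
        Ideal.Quotient.algebraMap_eq, Ideal.Quotient.eq_zero_iff_mem] at hn
      exact p.2.mem_of_pow_mem n hn
    exact h.of_iso (e.trans (Submodule.quotEquivOfEq _ _ hp)).symm.toModuleIso
  | exact N₁ N₂ N₃ f g hf hg hfg ih₁ ih₃ =>
    intro htors
    let S : ShortComplex (ModuleCat.{u} R) := ShortComplex.mk (ModuleCat.ofHom f)
      (ModuleCat.ofHom g) (by ext x; exact hfg.apply_apply_eq_zero x)
    have hS : S.ShortExact :=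
      { exact := (ShortComplex.ShortExact.moduleCat_exact_iff_function_exact S).2 hfg
        mono_f := (ModuleCat.mono_iff_injective _).2 hf
        epi_g := (ModuleCat.epi_iff_surjective _).2 hg }
    exact HomVanishesNonpos.of_shortExact hS
      (ih₁ fun a ha => (htors a ha).of_injective f hf)
      (ih₃ fun a ha => (htors a ha).of_surjective g hg)

lemma eq_zero_of_homVanishesNonpos_homology {B Y : DerivedCategory (ModuleCat.{u} R)}
    (hLE : B.IsLE 0) (hGE : B.IsGE 0)
    (hY : HomVanishesNonpos ((homologyFunctor (ModuleCat.{u} R) 0).obj B) Y)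
    (g : B ⟶ Y) : g = 0 := by
  obtain ⟨N, ⟨e⟩⟩ := exists_iso_singleFunctor_obj_of_isGE_of_isLE B 0
  have h := hY.of_iso ((homologyFunctor (ModuleCat.{u} R) 0).mapIso e ≪≫ singleHomologyIso N)
  rw [← Preadditive.IsIso.comp_left_eq_zero e.inv,
    ← Preadditive.IsIso.comp_right_eq_zero _ ((shiftFunctorZero _ ℤ).inv.app Y)]
  exact h 0 le_rfl _

/-- A bounded complex in nonpositive degrees has no nonzero morphism to `Y` if this holds for all
finitely generated torsion modules and the cohomology of the complex is of this kind. -/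
lemma eq_zero_of_homVanishesNonpos [IsNoetherianRing R] (s : Set R) (r : ℕ)
    (F Y : DerivedCategory (ModuleCat.{u} R)) (hLE : F.IsLE 0) (hGE : F.IsGE (-r))
    (hfin : ∀ n, Module.Finite R ((homologyFunctor (ModuleCat.{u} R) n).obj F))
    (htors : ∀ a ∈ s, ∀ n, IsPowerTorsion a ((homologyFunctor (ModuleCat.{u} R) n).obj F))
    (hY : ∀ (N : ModuleCat.{u} R), Module.Finite R N → (∀ a ∈ s, IsPowerTorsion a N) →
      HomVanishesNonpos N Y) (f : F ⟶ Y) : f = 0 := by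
  induction r generalizing F Y with
  | zero =>
    exact eq_zero_of_homVanishesNonpos_homology hLE (by simpa using hGE)
      (hY _ (hfin 0) fun a ha => htors a ha 0) f
  | succ r ih =>
    -- Truncation splits off the top cohomology: `B` is concentrated in degree 0 and `A` lives in
    -- degrees from -(r + 1) to -1.
    obtain ⟨A, B, hA, hB, i, p, δ, hT⟩ := TStructure.t.exists_triangle F (-1) 0 (by lia)
    have hA' : A.IsLE (-1) := ⟨hA⟩
    have hB' : B.IsGE 0 := ⟨hB⟩
    have hBLE : B.IsLE 0 := by
      rw [isLE_iff]
      exact fun n hn => isZero_homology_obj₃ _ hT n (isZero_of_isLE F 0 n hn)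
        (isZero_of_isLE A (-1) (n + 1) (by lia))
    have hex₁ (n : ℤ) := HomologySequence.exact₁ _ hT (n - 1) n
    have hB₀ (n : ℤ) (hn : n ≤ -1) :
        IsZero ((homologyFunctor (ModuleCat.{u} R) (n - 1)).obj B) :=
      isZero_of_isGE B 0 _ (by lia)
    have hA₀ (n : ℤ) (hn : ¬ n ≤ -1) :
        IsZero ((homologyFunctor (ModuleCat.{u} R) n).obj A) :=
      isZero_of_isLE A (-1) _ (by lia)
    have hfinZero {N : ModuleCat.{u} R} (hN : IsZero N) : Module.Finite R N := by
      have := ModuleCat.subsingleton_of_isZero hN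
      infer_instance
    have hAGE : A.IsGE (-(r + 1 : ℕ)) := by
      rw [isGE_iff]
      exact fun n hn => (hex₁ n).isZero_of_both_zeros
        ((hB₀ n (by lia)).eq_of_src _ _) ((isZero_of_isGE F _ n hn).eq_of_tgt _ _)
    have hAfin (n : ℤ) : Module.Finite R ((homologyFunctor (ModuleCat.{u} R) n).obj A) := by
      by_cases hn : n ≤ -1
      · exact finite_of_exact _ (hex₁ n) (hfinZero (hB₀ n hn)) (hfin n)
      · exact hfinZero (hA₀ n hn)
    have hAtors (a : R) (ha : a ∈ s) (n : ℤ) :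
        IsPowerTorsion a ((homologyFunctor (ModuleCat.{u} R) n).obj A) := by
      by_cases hn : n ≤ -1
      · exact IsPowerTorsion.of_shortComplex_exact _ (hex₁ n) (.of_isZero (hB₀ n hn))
          (htors a ha n)
      · exact .of_isZero (hA₀ n hn)
    have hex₃ := HomologySequence.exact₃ _ hT 0 1
    have hBfin : Module.Finite R ((homologyFunctor (ModuleCat.{u} R) 0).obj B) :=
      finite_of_exact _ hex₃ (hfin 0) (hAfin 1)
    have hBtors (a : R) (ha : a ∈ s) :
        IsPowerTorsion a ((homologyFunctor (ModuleCat.{u} R) 0).obj B) :=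
      IsPowerTorsion.of_shortComplex_exact _ hex₃ (htors a ha 0) (hAtors a ha 1)
    have hi : i ≫ f = 0 := by
      -- Shifting by -1 moves `A` into degrees from -r to 0, and the vanishing hypothesis on `Y`
      -- passes to `Y⟦-1⟧`.
      rw [← Functor.map_eq_zero_iff (shiftFunctor (DerivedCategory (ModuleCat.{u} R)) (-1 : ℤ))]
      exact ih _ _ (TStructure.t.isLE_shift A (-1) (-1) 0)
        (TStructure.t.isGE_shift A (-(r + 1 : ℕ)) (-1) (-r))
        (fun n => Module.Finite.equiv (homologyShiftIso A (-1) n _ rfl).symm.toLinearEquiv)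
        (fun a ha n => (hAtors a ha _).of_iso (homologyShiftIso A (-1) n _ rfl).symm)
        (fun N hN hN' => (hY N hN hN').shift (by lia)) _
    obtain ⟨g, rfl⟩ := exists_eq_comp_of_distTriang hT f hi
    rw [eq_zero_of_homVanishesNonpos_homology hBLE hB' (hY _ hBfin hBtors) g, comp_zero]

/-- If a torsion complex receives no nonzero morphism from nonnegative shifts of the residue field,
then its cohomology in degree `0` vanishes. -/
lemma isZero_homology_of_homVanishesNonpos [IsLocalRing R] [IsNoetherianRing R]
    {X : DerivedCategory (ModuleCat.{u} R)} (hX : IsTorsionComplex X)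
    (h : HomVanishesNonpos (ModuleCat.of R (IsLocalRing.ResidueField R)) X) :
    IsZero ((homologyFunctor (ModuleCat.{u} R) 0).obj X) := by
  obtain ⟨s, hs⟩ := (inferInstance : IsNoetherian R R).noetherian (IsLocalRing.maximalIdeal R)
  have hz (z : moduleInD R R ⟶ X) : z = 0 := by
    obtain ⟨F, u, v, rfl, hLE, ⟨r, hGE⟩, -, hfin, htors⟩ :=
      exists_factorization_of_isTorsionComplex hX z s
        (fun a ha => hs ▸ Submodule.subset_span ha)
    rw [eq_zero_of_homVanishesNonpos (s : Set R) r F X hLE hGE hfin htors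
      (fun N _ hN' => h.of_finite s hs N hN') v, comp_zero]
  refine ModuleCat.isZero_of_iff_subsingleton.2 ⟨fun x y => ?_⟩
  suffices ∀ x : (homologyFunctor (ModuleCat.{u} R) 0).obj X, x = 0 from
    (this x).trans (this y).symm
  intro x
  obtain ⟨g, e, he⟩ := exists_comp_homologyFunctor_map_eq
    (P := ModuleCat.of R R) (ModuleCat.ofHom (LinearMap.toSpanSingleton R _ x))
  rw [hz g, Functor.map_zero, comp_zero] at he
  have := congr($he (1 : R))
  simpa using this.symm

end DerivedCategory

/-! ### The injective hull of the residue field. -/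

section InjectiveHull

variable {R : Type u} [CommRing R] [IsLocalRing R]
  {E : Type u} [AddCommGroup E] [Module R E] {ι : IsLocalRing.ResidueField R →ₗ[R] E}

open DerivedCategory in
/-- The injective hull of the residue field is torsion with respect to the maximal ideal. -/
lemma IsInjectiveHull.isPowerTorsion [IsNoetherianRing R] (hE : IsInjectiveHull ι)
    {a : R} (ha : a ∈ IsLocalRing.maximalIdeal R) : IsPowerTorsion a E := by
  intro e
  let S : Submodule R E := Submodule.span R {e}
  let f : S →ₗ[R] S := a • LinearMap.id
  have hf (n : ℕ) (x : S) : (f ^ n) x = a ^ n • x := by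
    induction n with
    | zero => simp
    | succ n ih => rw [pow_succ', Module.End.mul_apply, ih, pow_succ', mul_smul]; rfl
  -- Fitting's lemma on the Noetherian module Re: for large n, the kernel and image of `a ^ n` are
  -- disjoint. As n ≥ 1, `a ^ n` kills ι(k), so the image misses ι(k) and is zero by essentiality.
  obtain ⟨n, hn, hn'⟩ := ((Module.End.eventually_disjoint_ker_pow_range_pow f).and
    (Filter.eventually_ge_atTop 1)).exists
  have h : (LinearMap.range (f ^ n)).map S.subtype = ⊥ := by
    refine hE.essential _ ((Submodule.eq_bot_iff _).2 ?_)
    rintro _ ⟨⟨y, hy, rfl⟩, ⟨c, hc⟩⟩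
    have hy₀ : y ∈ LinearMap.ker (f ^ n) := by
      rw [LinearMap.mem_ker, hf]
      apply Subtype.ext
      obtain ⟨n, rfl⟩ := Nat.exists_eq_add_of_le' hn'
      change a ^ (n + 1) • (S.subtype y) = 0
      rw [← hc, ← map_smul, pow_succ, mul_smul, smul_residueField_eq_zero ha, smul_zero, map_zero]
    rw [Submodule.disjoint_def.1 hn y hy₀ hy, map_zero]
  refine ⟨n, ?_⟩
  have h₁ : a ^ n • e ∈ (LinearMap.range (f ^ n)).map S.subtype :=
    ⟨(f ^ n) ⟨e, Submodule.mem_span_singleton_self e⟩, ⟨_, rfl⟩, by rw [hf]; rfl⟩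
  rw [h] at h₁
  exact h₁

/-- Every homomorphism from the residue field to its injective hull is a multiple of the canonical
embedding. -/
lemma IsInjectiveHull.exists_eq_comp_mulLeft (hE : IsInjectiveHull ι)
    (g : IsLocalRing.ResidueField R →ₗ[R] E) :
    ∃ c : IsLocalRing.ResidueField R, g = ι ∘ₗ LinearMap.mulLeft R c := by
  suffices ∃ c, g 1 = ι c by
    obtain ⟨c, hc⟩ := this
    refine ⟨c, LinearMap.ext fun x => ?_⟩
    obtain ⟨r, rfl⟩ := IsLocalRing.residue_surjective x
    have h₁ : IsLocalRing.residue R r = r • 1 := by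
      rw [Algebra.smul_def, mul_one, IsLocalRing.ResidueField.algebraMap_eq]
    rw [h₁, map_smul, hc, LinearMap.comp_apply, map_smul, map_smul]
    simp
  by_cases hg : g 1 = 0
  · exact ⟨0, by rw [hg, map_zero]⟩
  have hne : Submodule.span R {g 1} ⊓ LinearMap.range ι ≠ ⊥ := by
    intro h
    exact hg (Submodule.span_singleton_eq_bot.1 (hE.essential _ h))
  obtain ⟨y, ⟨hy, ⟨c, hc⟩⟩, hy₀⟩ := Submodule.exists_mem_ne_zero_of_ne_bot hne
  obtain ⟨r, rfl⟩ := Submodule.mem_span_singleton.1 hy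
  have hr : IsUnit r := by
    by_contra hr
    apply hy₀
    rw [← map_smul, smul_residueField_eq_zero ((IsLocalRing.mem_maximalIdeal r).2 hr), map_zero]
  obtain ⟨r, rfl⟩ := hr
  refine ⟨(↑r⁻¹ : R) • c, ?_⟩
  rw [map_smul, hc, smul_smul, Units.inv_mul, one_smul]

end InjectiveHull

/-! ### Mapping a bounded below torsion complex to the injective hull. -/

namespace DerivedCategory

open Limits HomologicalComplex Pretriangulated

/-- For n < 0 this is the t-structure; for n > 0 it is the vanishing of Ext into an injective. -/
lemma single_hom_shift_eq_zero_of_injective {C : Type*} [Category* C] [Abelian C]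
    [HasDerivedCategory.{w} C] (X I : C) [Injective I] (n : ℤ) (hn : n ≠ 0)
    (f : (singleFunctor C 0).obj X ⟶ ((singleFunctor C 0).obj I)⟦n⟧) : f = 0 := by
  have := hasExt_of_hasDerivedCategory.{w} C
  rcases hn.lt_or_gt with h | h
  · have := TStructure.t.isGE_shift ((singleFunctor C 0).obj I) 0 n (-n)
    exact TStructure.t.zero f 0 (-n)
  · obtain ⟨m, rfl⟩ := Int.eq_ofNat_of_zero_le h.le
    obtain ⟨m, rfl⟩ := Nat.exists_eq_add_of_le' (n := m) (m := 1) (by lia)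
    have h := Abelian.Ext.eq_zero_of_injective ((Abelian.Ext.homEquiv (X := X) (Y := I)).symm f)
    have h' := congrArg Abelian.Ext.hom h
    rw [Abelian.Ext.zero_hom] at h'
    exact ((Abelian.Ext.homEquiv (X := X) (Y := I)).apply_symm_apply f).symm.trans h'

section Local

variable {R : Type u} [CommRing R] [IsLocalRing R]

/-- An associated prime of `N` contains a power of every element of the maximal ideal, so it is
maximal and its witness `x` spans a copy of k. -/
lemma exists_residueField_injective [IsNoetherianRing R] {N : Type u} [AddCommGroup N] [Module R N]
    [Nontrivial N] (hN : ∀ a ∈ IsLocalRing.maximalIdeal R, IsPowerTorsion a N) :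
    ∃ f : IsLocalRing.ResidueField R →ₗ[R] N, Function.Injective f := by
  obtain ⟨p, hp⟩ := associatedPrimes.nonempty R N
  obtain ⟨hp, x, rfl⟩ := isAssociatedPrime_iff.1 hp
  have hmem (a : R) : a ∈ Submodule.colon (⊥ : Submodule R N) {x} ↔ a • x = 0 := by
    rw [Submodule.mem_colon_singleton, Submodule.mem_bot]
  have hle : IsLocalRing.maximalIdeal R ≤ Submodule.colon (⊥ : Submodule R N) {x} := by
    intro a ha
    obtain ⟨n, hn⟩ := hN a ha x
    exact hp.mem_of_pow_mem n ((hmem _).2 hn)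
  let f : IsLocalRing.ResidueField R →ₗ[R] N :=
    Submodule.liftQ (IsLocalRing.maximalIdeal R) (LinearMap.toSpanSingleton R N x)
      (fun a ha => (hmem a).1 (hle ha))
  have hf (r : R) : f (IsLocalRing.residue R r) = r • x := rfl
  refine ⟨f, (injective_iff_map_eq_zero f).2 fun c hc => ?_⟩
  obtain ⟨r, rfl⟩ := IsLocalRing.residue_surjective c
  rw [hf, ← hmem] at hc
  exact (IsLocalRing.residue_eq_zero_iff r).2 (IsLocalRing.le_maximalIdeal hp.ne_top hc)

variable [HasDerivedCategory.{w} (ModuleCat.{u} R)]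

/-- A bounded below torsion complex with nonzero cohomology in the lowest degree maps to the
injective hull of the residue field, compatibly with a map from the residue field. -/
lemma exists_fac_injectiveHull [IsNoetherianRing R] {E : Type u} [AddCommGroup E] [Module R E]
    {ι : IsLocalRing.ResidueField R →ₗ[R] E} (hE : Module.Injective R E)
    {X : DerivedCategory (ModuleCat.{u} R)} (hX : IsTorsionComplex X) [hGE : X.IsGE 0]
    (h₀ : ¬ IsZero ((homologyFunctor (ModuleCat.{u} R) 0).obj X)) :
    ∃ (f : moduleInD R (IsLocalRing.ResidueField R) ⟶ X) (g : X ⟶ moduleInD R E),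
      f ≫ g = (singleFunctor (ModuleCat.{u} R) 0).map (ModuleCat.ofHom ι) := by
  -- With a model in degrees ≥ 0, H⁰ is the submodule of cocycles in `K.X 0`; hence k embeds in `K.X
  -- 0`, and ι extends along this embedding.
  obtain ⟨K, _, ⟨e⟩⟩ := exists_iso_Q_obj_of_isGE X 0
  have hd : K.d (-1) 0 = 0 := (K.isZero_of_isStrictlyGE 0 (-1)).eq_of_src _ _
  have := K.isIso_homologyπ (-1) 0 (by simp) hd
  let e' : (homologyFunctor (ModuleCat.{u} R) 0).obj X ≅ K.cycles 0 :=
    (homologyFunctor _ 0).mapIso e ≪≫ homologyQIso K 0 ≪≫ (asIso (K.homologyπ 0)).symm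
  have : Nontrivial (K.cycles 0) := by
    by_contra h
    rw [not_nontrivial_iff_subsingleton] at h
    exact h₀ ((ModuleCat.isZero_of_subsingleton _).of_iso e')
  obtain ⟨j, hj⟩ := exists_residueField_injective (N := K.cycles 0)
    (fun a ha => (hX a ha 0).of_iso e')
  let j' : ModuleCat.of R (IsLocalRing.ResidueField R) ⟶ K.X 0 :=
    ModuleCat.ofHom j ≫ K.iCycles 0
  have : Mono (ModuleCat.ofHom j) := (ModuleCat.mono_iff_injective _).2 hj
  have : Mono j' := mono_comp _ _
  have : Injective (ModuleCat.of R E) := Module.injective_object_of_injective_module R E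
  let q : K.X 0 ⟶ ModuleCat.of R E := Injective.factorThru (ModuleCat.ofHom ι) j'
  have hq : j' ≫ q = ModuleCat.ofHom ι := Injective.comp_factorThru _ _
  let f : (single _ (.up ℤ) 0).obj (ModuleCat.of R (IsLocalRing.ResidueField R)) ⟶ K :=
    mkHomFromSingle j' (by simp [j'])
  let g : K ⟶ (single _ (.up ℤ) 0).obj (ModuleCat.of R E) :=
    mkHomToSingle q (by
      intro i hi
      exact (K.isZero_of_isStrictlyGE 0 i (by simp at hi; lia)).eq_of_src _ _)
  have hfg : f ≫ g = (single _ (.up ℤ) 0).map (ModuleCat.ofHom ι) := by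
    apply from_single_hom_ext
    simp [f, g, ← hq, single_map_f_self]
  refine ⟨(Q.map f ≫ e.inv :), (e.hom ≫ Q.map g :), ?_⟩
  have h : (Q.map f ≫ e.inv) ≫ (e.hom ≫ Q.map g) =
      Q.map ((single _ (.up ℤ) 0).map (ModuleCat.ofHom ι)) := by
    rw [Category.assoc, e.inv_hom_id_assoc, ← Functor.map_comp, hfg]
  exact h

end Local

end DerivedCategory

/-! ### Induction on the total dimension of RHom(k, -). -/

namespace DerivedCategory

open Limits HomologicalComplex Pretriangulated

section ShiftZero

variable {C : Type*} [Category* C] [HasShift C ℤ]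

lemma shiftFunctorZero_inv_comp_map_eq {A X Y : C} {g : X ⟶ Y} {f : A ⟶ X} {h : A ⟶ Y⟦(0 : ℤ)⟧}
    (hfg : f ≫ g = h ≫ (shiftFunctorZero C ℤ).hom.app Y) :
    (f ≫ (shiftFunctorZero C ℤ).inv.app X) ≫ g⟦(0 : ℤ)⟧' = h := by
  have hnat : g ≫ (shiftFunctorZero C ℤ).inv.app Y =
    (shiftFunctorZero C ℤ).inv.app X ≫ g⟦(0 : ℤ)⟧' := (shiftFunctorZero C ℤ).inv.naturality g
  rw [Category.assoc, ← hnat, ← Category.assoc, hfg]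
  simp

lemma eq_comp_of_shift_zero_comp_map_eq {A X Y : C} {i : X ⟶ Y} {f : A ⟶ Y} {x : A ⟶ X⟦(0 : ℤ)⟧}
    (hx : x ≫ i⟦(0 : ℤ)⟧' = f ≫ (shiftFunctorZero C ℤ).inv.app Y) :
    f = (x ≫ (shiftFunctorZero C ℤ).hom.app X) ≫ i := by
  have hnat : i⟦(0 : ℤ)⟧' ≫ (shiftFunctorZero C ℤ).hom.app Y =
    (shiftFunctorZero C ℤ).hom.app X ≫ i := (shiftFunctorZero C ℤ).hom.naturality i
  rw [Category.assoc, ← hnat, ← Category.assoc, hx]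
  simp

end ShiftZero

/-- In the long exact sequence of Hom(A, -), surjectivity in degree n - 1 kills the connecting map
into degree n. -/
lemma comp_shift_map_injective_of_distTriang {C : Type*} [Category* C] [Abelian C]
    [HasDerivedCategory C] {A X' X Y : DerivedCategory C}
    {i : X' ⟶ X} {g : X ⟶ Y} {δ : Y ⟶ X'⟦(1 : ℤ)⟧} (hT : Triangle.mk i g δ ∈ distTriang _) (n : ℤ)
    (hlift : ∀ h : A ⟶ Y⟦n - 1⟧, ∃ y : A ⟶ X⟦n - 1⟧, y ≫ g⟦n - 1⟧' = h)
    (x₁ x₂ : A ⟶ X'⟦n⟧) (hx : x₁ ≫ i⟦n⟧' = x₂ ≫ i⟦n⟧') : x₁ = x₂ := by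
  let F := preadditiveCoyoneda.obj (Opposite.op A)
  have hepi : Epi ((F.shift (n - 1)).map (Triangle.mk i g δ).mor₂) := by
    rw [AddCommGrpCat.epi_iff_surjective]
    exact hlift
  have hmono : Mono ((F.shift n).map (Triangle.mk i g δ).mor₁) := by
    rw [F.homologySequence_mono_shift_map_mor₁_iff _ hT (n - 1) n (by lia),
      ← F.homologySequence_epi_shift_map_mor₂_iff _ hT (n - 1) n (by lia)]
    exact hepi
  rw [AddCommGrpCat.mono_iff_injective] at hmono
  exact hmono hx

variable {R : Type u} [CommRing R] [IsLocalRing R] [HasDerivedCategory.{w} (ModuleCat.{u} R)]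

open IsLocalRing

/-- The map on the cohomology of `RHom(k, -)` induced by a morphism. -/
noncomputable def rHomCohomologyMap {X Y : DerivedCategory (ModuleCat.{u} R)} {n m : ℤ}
    (f : X⟦n⟧ ⟶ Y⟦m⟧) : RHomCohomology R X n →ₗ[ResidueField R] RHomCohomology R Y m where
  toFun (x : moduleInD R (ResidueField R) ⟶ X⟦n⟧) := x ≫ f
  map_add' _ _ := Preadditive.add_comp _ _ _ _ _ _
  map_smul' _ _ := Category.assoc _ _ _

/-- The map on the total cohomology of `RHom(k, -)` induced by a morphism. -/
noncomputable def totalRHomMap {X Y : DerivedCategory (ModuleCat.{u} R)} (f : X ⟶ Y) :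
    (DirectSum ℤ fun n => RHomCohomology R X n) →ₗ[ResidueField R]
      (DirectSum ℤ fun n => RHomCohomology R Y n) :=
  DirectSum.lmap fun n => rHomCohomologyMap (f⟦n⟧')

/-- The cohomology of `RHom(k, X[i])` in degree `n` is that of `RHom(k, X)` in degree `i + n`. -/
noncomputable def rHomCohomologyShiftEquiv (X : DerivedCategory (ModuleCat.{u} R)) (i n : ℤ) :
    RHomCohomology R (X⟦i⟧) n ≃ₗ[ResidueField R] RHomCohomology R X (i + n) :=
  { rHomCohomologyMap (X := X⟦i⟧) (Y := X) (n := n) (m := i + n)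
      ((shiftFunctorAdd _ i n).inv.app X) with
    invFun := fun (x : moduleInD R (ResidueField R) ⟶ X⟦i + n⟧) =>
      x ≫ (shiftFunctorAdd _ i n).hom.app X
    left_inv := fun (x : moduleInD R (ResidueField R) ⟶ (X⟦i⟧)⟦n⟧) => by
      change (x ≫ _) ≫ _ = x
      simp
    right_inv := fun (x : moduleInD R (ResidueField R) ⟶ X⟦i + n⟧) => by
      change (x ≫ _) ≫ _ = x
      simp }

/-- Shifting does not change the total cohomology of `RHom(k, -)`. -/
noncomputable def totalRHomShiftEquiv (X : DerivedCategory (ModuleCat.{u} R)) (i : ℤ) :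
    (DirectSum ℤ fun n => RHomCohomology R (X⟦i⟧) n) ≃ₗ[ResidueField R]
      (DirectSum ℤ fun n => RHomCohomology R X n) :=
  DFinsupp.mapRange.linearEquiv (fun n => rHomCohomologyShiftEquiv X i n) ≪≫ₗ
    (DirectSum.lequivCongrLeft (ResidueField R) (M := fun n => RHomCohomology R X n)
      (Equiv.addLeft i).symm).symm

/-- Finitely many generators of a direct sum involve only finitely many degrees. -/
lemma exists_homVanishesNonpos_of_finite {M : DerivedCategory (ModuleCat.{u} R)}
    (hfin : RHomResidueFieldFinite R M) :
    ∃ n₀ : ℤ, ∀ n ≤ n₀, ∀ f : moduleInD R (ResidueField R) ⟶ M⟦n⟧, f = 0 := by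
  obtain ⟨T, hT⟩ := (Module.finite_def.1 hfin : (⊤ : Submodule (ResidueField R) _).FG)
  have hbound : ∃ n₀ : ℤ, ∀ t ∈ T, ∀ n ≤ n₀, t n = 0 := by
    classical
    obtain ⟨b, hb⟩ := (T.biUnion fun t => DFinsupp.support t).bddBelow
    refine ⟨b - 1, fun t ht n hn => ?_⟩
    by_contra h
    have := hb (Finset.mem_coe.2 (Finset.mem_biUnion.2 ⟨t, ht, DFinsupp.mem_support_iff.2 h⟩))
    lia
  obtain ⟨n₀, hn₀⟩ := hbound
  have hall (x : DirectSum ℤ fun n => RHomCohomology R M n) : ∀ n ≤ n₀, x n = 0 := by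
    have hx : x ∈ Submodule.span (ResidueField R) (T : Set _) := hT ▸ Submodule.mem_top
    induction hx using Submodule.span_induction with
    | mem t ht => exact hn₀ t ht
    | zero => exact fun n _ => rfl
    | add x y _ _ hx hy => exact fun n hn => by rw [DirectSum.add_apply, hx n hn, hy n hn, add_zero]
    | smul c x _ hx => exact fun n hn => by rw [DirectSum.smul_apply, hx n hn, smul_zero]
  refine ⟨n₀, fun n hn f => ?_⟩
  exact (DirectSum.of_eq_same (β := fun n => RHomCohomology R M n) n f).symm.trans (hall _ n hn)

/-- Only n = 0 matters, and there every map k → E is a multiple of ι, which lifts to `f`. -/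
lemma exists_lift_shift_of_fac {E : Type u} [AddCommGroup E] [Module R E]
    {ι : ResidueField R →ₗ[R] E} (hE : IsInjectiveHull ι)
    {X : DerivedCategory (ModuleCat.{u} R)}
    (f : moduleInD R (ResidueField R) ⟶ X) (g : X ⟶ moduleInD R E)
    (hfg : f ≫ g = (singleFunctor (ModuleCat.{u} R) 0).map (ModuleCat.ofHom ι))
    (n : ℤ) (h : moduleInD R (ResidueField R) ⟶ (moduleInD R E)⟦n⟧) :
    ∃ y : moduleInD R (ResidueField R) ⟶ X⟦n⟧, y ≫ g⟦n⟧' = h := by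
  by_cases hn : n = 0
  · subst hn
    obtain ⟨l, hl⟩ := (singleFunctor (ModuleCat.{u} R) 0).map_surjective
      (h ≫ (shiftFunctorZero _ ℤ).hom.app _)
    obtain ⟨c, hc⟩ := hE.exists_eq_comp_mulLeft l.hom
    refine ⟨(residueMul R c ≫ f) ≫ (shiftFunctorZero _ ℤ).inv.app X,
      shiftFunctorZero_inv_comp_map_eq ?_⟩
    rw [Category.assoc, hfg, ← hl, residueMul, ← Functor.map_comp]
    congr 1
    exact ModuleCat.hom_ext hc.symm
  · have : Injective (ModuleCat.of R E) :=
      have := hE.injective_module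
      Module.injective_object_of_injective_module R E
    exact ⟨0, by rw [zero_comp, single_hom_shift_eq_zero_of_injective _ _ n hn h]⟩

lemma finrank_totalRHom_fiber_lt [IsNoetherianRing R] {E : Type u} [AddCommGroup E] [Module R E]
    {ι : ResidueField R →ₗ[R] E} (hE : IsInjectiveHull ι)
    {X : DerivedCategory (ModuleCat.{u} R)} (hX : IsTorsionComplex X)
    (hfin : RHomResidueFieldFinite R X)
    (f : moduleInD R (ResidueField R) ⟶ X) (g : X ⟶ moduleInD R E)
    (hfg : f ≫ g = (singleFunctor (ModuleCat.{u} R) 0).map (ModuleCat.ofHom ι))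
    {X' : DerivedCategory (ModuleCat.{u} R)} {i : X' ⟶ X} {δ : moduleInD R E ⟶ X'⟦(1 : ℤ)⟧}
    (hT : Triangle.mk i g δ ∈ distTriang _) :
    IsTorsionComplex X' ∧ RHomResidueFieldFinite R X' ∧
      Module.finrank (ResidueField R) (DirectSum ℤ fun n => RHomCohomology R X' n) <
        Module.finrank (ResidueField R) (DirectSum ℤ fun n => RHomCohomology R X n) := by
  refine ⟨fun a ha n => ?_, ?_⟩
  · refine IsPowerTorsion.of_shortComplex_exact _ (HomologySequence.exact₁ _ hT (n - 1) n) ?_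
      (hX a ha n)
    exact isPowerTorsion_homology_single _ (hE.isPowerTorsion ha) _
  have hinj : Function.Injective (totalRHomMap i) := (DirectSum.lmap_injective _).2 fun n =>
    comp_shift_map_injective_of_distTriang hT n (exists_lift_shift_of_fac hE f g hfg (n - 1))
  -- The class of `f` is missed: if it came from `X'`, then `f ≫ g`, which is ι, would vanish.
  have hnsurj : ¬ Function.Surjective (totalRHomMap i) := by
    intro hsurj
    obtain ⟨x, hx⟩ := (DirectSum.lmap_surjective _).1 hsurj 0
      (f ≫ (shiftFunctorZero _ ℤ).inv.app X)
    have hig : i ≫ g = 0 := comp_distTriang_mor_zero₁₂ _ hT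
    have h₀ : f ≫ g = 0 := by
      rw [eq_comp_of_shift_zero_comp_map_eq (x := x) (i := i) hx, Category.assoc,
        hig, comp_zero]
    rw [hfg] at h₀
    have h₁ : ModuleCat.ofHom ι = 0 :=
      (singleFunctor (ModuleCat.{u} R) 0).map_injective (h₀.trans (Functor.map_zero _ _ _).symm)
    have h₂ : ι 1 = 0 := congr($h₁ (1 : ResidueField R))
    exact one_ne_zero (hE.injective_map (h₂.trans (map_zero ι).symm))
  have : Module.Finite (ResidueField R) (DirectSum ℤ fun n => RHomCohomology R X n) := hfin
  refine ⟨Module.Finite.of_injective _ hinj, ?_⟩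
  rw [← LinearMap.finrank_range_of_inj hinj]
  exact Submodule.finrank_lt (mt LinearMap.range_eq_top.1 hnsurj)

/-- A complex with torsion cohomology such that `RHom(k, -)` has finite-dimensional total
cohomology belongs to the thick subcategory generated by the injective hull of `k`. -/
theorem triangEnvelope_of_isTorsionComplex [IsNoetherianRing R] {E : Type u} [AddCommGroup E]
    [Module R E] {ι : ResidueField R →ₗ[R] E} (hE : IsInjectiveHull ι)
    (M : DerivedCategory (ModuleCat.{u} R)) (hM : IsTorsionComplex M)
    (hfin : RHomResidueFieldFinite R M) :
    (ObjectProperty.singleton (moduleInD R E)).triangEnvelope M := by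
  induction hd : Module.finrank (ResidueField R) (DirectSum ℤ fun n => RHomCohomology R M n)
    using Nat.strong_induction_on generalizing M with
  | _ d ih =>
    -- The base of the induction is M = 0, detected by cohomology rather than by d = 0.
    by_cases hzero : ∀ n, IsZero ((homologyFunctor (ModuleCat.{u} R) n).obj M)
    · have h₁ : M.IsGE 1 := (isGE_iff M 1).2 fun n _ => hzero n
      have h₀ : M.IsLE 0 := (isLE_iff M 0).2 fun n _ => hzero n
      exact ObjectProperty.prop_of_isZero _ (TStructure.t.isZero M 0 1)
    push Not at hzero
    obtain ⟨n₀, hn₀⟩ := exists_homVanishesNonpos_of_finite hfin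
    have hvanish (n : ℤ) (hn : n ≤ n₀) :
        IsZero ((homologyFunctor (ModuleCat.{u} R) n).obj M) := by
      refine (isZero_homology_of_homVanishesNonpos (hM.shift n) fun m hm f => ?_).of_iso
        (homologyShiftIso M n 0 n (add_zero n)).symm
      rw [← Preadditive.IsIso.comp_right_eq_zero f ((shiftFunctorAdd _ n m).inv.app M)]
      exact hn₀ (n + m) (by lia) _
    obtain ⟨i, hi, hi'⟩ := Int.exists_least_of_bdd
      ⟨n₀, fun n hn => by by_contra h; exact hn (hvanish n (by lia))⟩ hzero
    have hGE : (M⟦i⟧).IsGE 0 := by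
      rw [isGE_iff]
      intro n hn
      refine IsZero.of_iso ?_ (homologyShiftIso M i n (i + n) rfl)
      by_contra h
      have := hi' _ h
      lia
    have hne : ¬ IsZero ((homologyFunctor (ModuleCat.{u} R) 0).obj (M⟦i⟧)) :=
      fun h => hi (h.of_iso (homologyShiftIso M i 0 i (add_zero i)).symm)
    obtain ⟨f, g, hfg⟩ := exists_fac_injectiveHull (ι := ι) hE.injective_module (hM.shift i) hne
    obtain ⟨X', j, δ, hT⟩ := distinguished_cocone_triangle₁ g
    have hfin' : RHomResidueFieldFinite R (M⟦i⟧) := by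
      have : Module.Finite (ResidueField R) (DirectSum ℤ fun n => RHomCohomology R M n) := hfin
      exact Module.Finite.equiv (totalRHomShiftEquiv M i).symm
    obtain ⟨h₁, h₂, h₃⟩ := finrank_totalRHom_fiber_lt hE (hM.shift i) hfin' f g hfg hT
    rw [(totalRHomShiftEquiv M i).finrank_eq, hd] at h₃
    have hX' := ih _ h₃ X' h₁ h₂ rfl
    have hMi : (ObjectProperty.singleton (moduleInD R E)).triangEnvelope (M⟦i⟧) :=
      ObjectProperty.ext_of_isTriangulatedClosed₂ _ _ hT hX'
        (ObjectProperty.le_triangEnvelope _ _ (by simp))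
    exact ObjectProperty.prop_of_iso _ ((shiftEquiv _ i).unitIso.symm.app M)
      (((ObjectProperty.singleton (moduleInD R E)).triangEnvelope).le_shift (-i) _ hMi)

end DerivedCategory

theorem lemma8p2 {R : Type u} [CommRing R] [IsLocalRing R] [IsNoetherianRing R]
    [HasDerivedCategory.{w} (ModuleCat.{u} R)]
    {E : Type u} [AddCommGroup E] [Module R E]
    (ι : IsLocalRing.ResidueField R →ₗ[R] E) (hE : IsInjectiveHull ι)
    (M : DerivedCategory (ModuleCat.{u} R))
    (hM : locSubcategory
      (ObjectProperty.singleton (moduleInD R (IsLocalRing.ResidueField R))) M)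
    (hfin : RHomResidueFieldFinite R M) :
    (ObjectProperty.singleton (moduleInD R E)).triangEnvelope M :=
  DerivedCategory.triangEnvelope_of_isTorsionComplex hE M
    (DerivedCategory.isTorsionComplex_of_locSubcategory hM) hfin
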